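/- **Setting.** Let $\mathcal X_1,\dots,\mathcal X_N\subset\mathbb R$ be non-empty and compact, $\boldsymbol{\mathcal X}:=\mathcal X_1\times\cdots\times\mathcal X_N$, and let $\mu_i$ be a Borel probability measure on $\mathcal X_i$. Let $c_1\in\mathbb R^{K_1}$, let $S_1:=\{a\in\mathbb R^{K_1}:L_{\mathrm{in}}a\le q_{\mathrm{in}},\ L_{\mathrm{eq}}a=q_{\mathrm{eq}}\}$ be non-empty, let $S_2^*\subset\mathbb R^{K_2^*}$ be a non-empty polytope, $V\in\mathbb R^{K_2^*\times K_1}$, $W\in\mathbb R^{K_2^*\times N}$, $b\in\mathbb R^{K_2^*}$. Put $Q_{\mathrm{aug}}(a,x,\lambda):=\langle Va+Wx+b,\lambda\rangle$ and $Q(a,x):=\max_{\lambda\in S_2^*}Q_{\mathrm{aug}}(a,x,\lambda)$. Let $\Gamma(\nu_1,\dots,\nu_N)$ be the set of Borel probability measures on $\boldsymbol{\mathcal X}$ with marginals $\nu_1,\dots,\nu_N$, and $\Gamma_{\mathrm{aug}}(\nu_1,\dots,\nu_N)$ the set of Borel probability measures on $\boldsymbol{\mathcal X}\times S_2^*$ with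 marginal $\nu_i$ on $\mathcal X_i$ for every $i$. Let $W_1(\mu,\nu)$ be the infimum of $\int|x-y|\,d\gamma$ over the couplings $\gamma$ of $\mu$ and $\nu$. For each $i$ let $\mathcal G_i$ be a set of Borel measurable, $\mu_i$-integrable functions $\mathcal X_i\to\mathbb R$. The moment set $[\mu_i]_{\mathcal G_i}$ is the set of Borel probability measures $\nu$ on $\mathcal X_i$ such that every $g\in\mathcal G_i$ is $\nu$-integrable with $\int g\,d\nu=\int g\,d\mu_i$; let $\overline W_{1,\mu_i}([\mu_i]_{\mathcal G_i}):=\sup_{\nu\in[\mu_i]_{\mathcal G_i}}W_1(\mu_i,\nu)$, and let $\Gamma_{\mathrm{aug}}([\mu_1]_{\mathcal G_1},\dots,[\mu_N]_{\mathcal G_N})$ be the union of the sets $\Gamma_{\mathrm{aug}}(\nu_1,\dots,\nu_N)$ over all $\nu_i\in[\mu_i]_{\mathcal G_i}$. For a Borel probability measure $\hat\mu$ on $\boldsymbol{\mathcal X}\times S_2^*$ with marginals $\hat\mu_i$ on $\mathcal X_i$, a *partial reassembly* of $\hat\mu$ (with marginals $\mu_1,\dots,\mu_N$) is a measure $\tilde\mu\in\Gamma_{\mathrm{aug}}(\mu_1,\dots,\mu_N)$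 for which there is a Borel probability measure $\gamma$ on $\{(x,\bar x,\lambda)\in\boldsymbol{\mathcal X}\times\boldsymbol{\mathcal X}\times S_2^*\}$ such that the marginal of $\gamma$ in $(x,\lambda)$ is $\hat\mu$, the marginal in $(\bar x,\lambda)$ is $\tilde\mu$, and for every $i$ the marginal in $(x_i,\bar x_i)$ is a coupling of $\hat\mu_i$ and $\mu_i$ with $\int|x_i-\bar x_i|\,d\gamma=W_1(\hat\mu_i,\mu_i)$. For $a\in S_1$ let $$\phi(a):=\langle c_1,a\rangle+\sup_{\mu\in\Gamma(\mu_1,\dots,\mu_N)}\int Q(a,x)\,d\mu,\qquad \phi_{\mathrm{sur}}(a):=\langle c_1,a\rangle+\sup_{\mu\in\Gamma_{\mathrm{aug}}([\mu_1]_{\mathcal G_1},\dots,[\mu_N]_{\mathcal G_N})}\int Q_{\mathrm{aug}}(a,x,\lambda)\,d\mu .$$ **Theorem (Approximation of DRO).** Let $\bar\epsilon:=\Big(\sum_{i=1}^N\overline W_{1,\mu_i}([\mu_i]_{\mathcal G_i})\Big)\cdot\sup_{\lambda\in S_2^*}\|W^{\mathsf T}\lambda\|_\infty$, and let $\epsilon>0$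 be arbitrary. 1. For every $\hat\mu\in\Gamma_{\mathrm{aug}}([\mu_1]_{\mathcal G_1},\dots,[\mu_N]_{\mathcal G_N})$ and every partial reassembly $\tilde\mu$ of $\hat\mu$ with marginals $\mu_1,\dots,\mu_N$, $$\int\langle Wx+b,\lambda\rangle\,d\hat\mu-\int\langle Wx+b,\lambda\rangle\,d\tilde\mu\le\bar\epsilon .$$ 2. Let $a\in S_1$ and let $\hat\mu\in\Gamma_{\mathrm{aug}}([\mu_1]_{\mathcal G_1},\dots,[\mu_N]_{\mathcal G_N})$ satisfy $\int Q_{\mathrm{aug}}(a,\cdot)\,d\hat\mu\ge\sup_{\mu\in\Gamma_{\mathrm{aug}}([\mu_1]_{\mathcal G_1},\dots,[\mu_N]_{\mathcal G_N})}\int Q_{\mathrm{aug}}(a,\cdot)\,d\mu-\epsilon$. Then every partial reassembly $\tilde\mu$ of $\hat\mu$ with marginals $\mu_1,\dots,\mu_N$ lies in $\Gamma_{\mathrm{aug}}(\mu_1,\dots,\mu_N)$ and satisfies $\int Q_{\mathrm{aug}}(a,\cdot)\,d\tilde\mu\ge\sup_{\mu\in\Gamma_{\mathrm{aug}}(\mu_1,\dots,\mu_N)}\int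 Q_{\mathrm{aug}}(a,\cdot)\,d\mu-(\epsilon+\bar\epsilon)$. 3. $\phi_{\mathrm{sur}}(a)-\bar\epsilon\le\phi(a)\le\phi_{\mathrm{sur}}(a)$ for all $a\in S_1$. 4. $\inf_{a\in S_1}\phi_{\mathrm{sur}}(a)-\bar\epsilon\le\inf_{a\in S_1}\phi(a)\le\inf_{a\in S_1}\phi_{\mathrm{sur}}(a)$, where the infima may be $-\infty$. -/

import Mathlib

open MeasureTheory
open scoped Matrix

noncomputable section

namespace MarginalDRO

/-! ### Measures: couplings, the Wasserstein distance of order one, moment sets -/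

/-- `Γ(ν₁, …, ν_N)`: the Borel probability measures on `Y₁ × ⋯ × Y_N` whose marginal on `Y_i`
is `ν_i` for every `i`. -/
def couplings {N : ℕ} {Y : Fin N → Type} [∀ i, MeasurableSpace (Y i)]
    (ν : ∀ i, Measure (Y i)) : Set (Measure (∀ i, Y i)) :=
  {γ | IsProbabilityMeasure γ ∧ ∀ i, γ.map (fun x => x i) = ν i}

/-- `Γ(μ, ν)`: the couplings of two measures. -/
def couplings₂ {Y Z : Type} [MeasurableSpace Y] [MeasurableSpace Z]
    (μ : Measure Y) (ν : Measure Z) : Set (Measure (Y × Z)) :=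
  {γ | IsProbabilityMeasure γ ∧ γ.map Prod.fst = μ ∧ γ.map Prod.snd = ν}

/-- `W₁(μ, ν)` for probability measures on `Y ⊆ ℝ`: the infimum of `∫ |x - y| dγ` over all
couplings `γ`. (For compact `Y` all these integrals are finite.) -/
def W₁ {Y : Set ℝ} (μ ν : Measure Y) : ℝ :=
  sInf ((fun γ : Measure (Y × Y) => ∫ p, |(p.1 : ℝ) - (p.2 : ℝ)| ∂γ) '' couplings₂ μ ν)

/-- `P(Y; G)`: the Borel probability measures on `Y` that integrate every `g ∈ G`. -/
def probIntegrating {Y : Type} [MeasurableSpace Y] (G : Set (Y → ℝ)) : Set (Measure Y) :=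
  {ν | IsProbabilityMeasure ν ∧ ∀ g ∈ G, Integrable g ν}

/-- The moment set `[μ]_G`: the measures `ν ∈ P(Y; G)` with `∫ g dν = ∫ g dμ` for `g ∈ G`. -/
def momentSet {Y : Type} [MeasurableSpace Y] (G : Set (Y → ℝ)) (μ : Measure Y) :
    Set (Measure Y) :=
  {ν | ν ∈ probIntegrating G ∧ ∀ g ∈ G, ∫ y, g y ∂ν = ∫ y, g y ∂μ}

/-- `W̄_{1,μ}([μ]_G) = sup {W₁(μ, ν) : ν ∈ [μ]_G}`.
(For compact `Y` this set is bounded by the diameter of `Y`.) -/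
def supW₁ {Y : Set ℝ} (G : Set (Y → ℝ)) (μ : Measure Y) : ℝ :=
  sSup ((fun ν : Measure Y => W₁ μ ν) '' momentSet G μ)

/-- `Γ_aug(ν₁, …, ν_N)`: the probability measures on `(Y₁ × ⋯ × Y_N) × S` whose marginal on `Y_i`
is `ν_i` for every `i`; the marginal on `S` is free. -/
def augCouplings {N : ℕ} {Y : Fin N → Type} [∀ i, MeasurableSpace (Y i)]
    (S : Type) [MeasurableSpace S] (ν : ∀ i, Measure (Y i)) :
    Set (Measure ((∀ i, Y i) × S)) :=
  {γ | IsProbabilityMeasure γ ∧ ∀ i, γ.map (fun p => p.1 i) = ν i}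

/-- `Γ_aug([μ₁]_{G₁}, …, [μ_N]_{G_N})`: the union of the sets `Γ_aug(ν₁, …, ν_N)` over all
`ν_i ∈ [μ_i]_{G_i}`. -/
def augCouplingsMoment {N : ℕ} {Y : Fin N → Type} [∀ i, MeasurableSpace (Y i)]
    (S : Type) [MeasurableSpace S] (G : ∀ i, Set (Y i → ℝ)) (μ : ∀ i, Measure (Y i)) :
    Set (Measure ((∀ i, Y i) × S)) :=
  {γ | ∃ ν : ∀ i, Measure (Y i), (∀ i, ν i ∈ momentSet (G i) (μ i)) ∧ γ ∈ augCouplings S ν}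

/-- `R_part(μhat; μ₁, …, μ_N)`: the partial reassemblies of `μhat` with marginals `μ₁, …, μ_N`.
A point of the domain of `γ` is `(x, xbar, l)`. -/
def partialReassemblies {N : ℕ} {X : Fin N → Set ℝ} {S : Type} [MeasurableSpace S]
    (μhat : Measure ((∀ i, X i) × S)) (μ : ∀ i, Measure (X i)) :
    Set (Measure ((∀ i, X i) × S)) :=
  {μtil | μtil ∈ augCouplings S μ ∧
    ∃ γ : Measure ((∀ i, X i) × (∀ i, X i) × S), IsProbabilityMeasure γ ∧
      γ.map (fun p => (p.1, p.2.2)) = μhat ∧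
      (∀ i, γ.map (fun p => (p.1 i, p.2.1 i)) ∈
          couplings₂ (μhat.map (fun q => q.1 i)) (μ i) ∧
        ∫ q, |(q.1 : ℝ) - (q.2 : ℝ)| ∂(γ.map (fun p => (p.1 i, p.2.1 i)))
          = W₁ (μhat.map (fun q => q.1 i)) (μ i)) ∧
      γ.map (fun p => (p.2.1, p.2.2)) = μtil}

/-! ### The two-stage problem -/

/-- A polytope in `ℝ^K`: a bounded intersection of finitely many closed half-spaces. -/
def IsPolytope {K : ℕ} (S : Set (Fin K → ℝ)) : Prop :=
  Bornology.IsBounded S ∧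
    ∃ (n : ℕ) (A : Matrix (Fin n) (Fin K) ℝ) (d : Fin n → ℝ), S = {l | A *ᵥ l ≤ d}

/-- The first-stage feasible set `S₁ = {a : L_in a ≤ q_in, L_eq a = q_eq}`. -/
def firstStageSet {K₁ nin neq : ℕ} (Lin : Matrix (Fin nin) (Fin K₁) ℝ) (qin : Fin nin → ℝ)
    (Leq : Matrix (Fin neq) (Fin K₁) ℝ) (qeq : Fin neq → ℝ) : Set (Fin K₁ → ℝ) :=
  {a | Lin *ᵥ a ≤ qin ∧ Leq *ᵥ a = qeq}

/-- `Q_aug(a, x, l) = ⟨V a + W x + b, l⟩`. -/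
def Qaug {N K₁ K₂ : ℕ} (V : Matrix (Fin K₂) (Fin K₁) ℝ) (W : Matrix (Fin K₂) (Fin N) ℝ)
    (b : Fin K₂ → ℝ) (a : Fin K₁ → ℝ) (x : Fin N → ℝ) (l : Fin K₂ → ℝ) : ℝ :=
  (V *ᵥ a + W *ᵥ x + b) ⬝ᵥ l

/-- `Q(a, x) = max {⟨V a + W x + b, l⟩ : l ∈ S}`. (On a non-empty polytope `S` the supremum
of this linear function is attained.) -/
def Q {N K₁ K₂ : ℕ} (V : Matrix (Fin K₂) (Fin K₁) ℝ) (W : Matrix (Fin K₂) (Fin N) ℝ)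
    (b : Fin K₂ → ℝ) (S : Set (Fin K₂ → ℝ)) (a : Fin K₁ → ℝ) (x : Fin N → ℝ) : ℝ :=
  sSup ((fun l => Qaug V W b a x l) '' S)

/-- `∫ Q_aug(a, x, l) dγ(x, l)`. -/
def augCost {N K₁ K₂ : ℕ} (V : Matrix (Fin K₂) (Fin K₁) ℝ) (W : Matrix (Fin K₂) (Fin N) ℝ)
    (b : Fin K₂ → ℝ) {S : Set (Fin K₂ → ℝ)} {X : Fin N → Set ℝ} (a : Fin K₁ → ℝ)
    (γ : Measure ((∀ i, X i) × S)) : ℝ :=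
  ∫ p, Qaug V W b a (fun i => (p.1 i : ℝ)) (p.2 : Fin K₂ → ℝ) ∂γ

/-- `φ(a) = ⟨c₁, a⟩ + sup {∫ Q(a, x) dμ(x) : μ ∈ Γ(μ₁, …, μ_N)}`, the supremum being taken in the
extended reals. -/
def phi {N K₁ K₂ : ℕ} (c₁ : Fin K₁ → ℝ) (V : Matrix (Fin K₂) (Fin K₁) ℝ)
    (W : Matrix (Fin K₂) (Fin N) ℝ) (b : Fin K₂ → ℝ) (S : Set (Fin K₂ → ℝ))
    {X : Fin N → Set ℝ} (μ : ∀ i, Measure (X i)) (a : Fin K₁ → ℝ) : EReal :=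
  ((c₁ ⬝ᵥ a : ℝ) : EReal) +
    ⨆ γ ∈ couplings μ, ((∫ x, Q V W b S a (fun i => (x i : ℝ)) ∂γ : ℝ) : EReal)

/-- The surrogate `φ_sur(a) = ⟨c₁, a⟩ + sup ∫ Q_aug(a, x, l) dγ(x, l)`, the supremum being taken
over `γ ∈ Γ_aug([μ₁]_{G₁}, …, [μ_N]_{G_N})` in the extended reals. -/
def phiSur {N K₁ K₂ : ℕ} (c₁ : Fin K₁ → ℝ) (V : Matrix (Fin K₂) (Fin K₁) ℝ)
    (W : Matrix (Fin K₂) (Fin N) ℝ) (b : Fin K₂ → ℝ) (S : Set (Fin K₂ → ℝ))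
    {X : Fin N → Set ℝ} (G : ∀ i, Set (X i → ℝ)) (μ : ∀ i, Measure (X i))
    (a : Fin K₁ → ℝ) : EReal :=
  ((c₁ ⬝ᵥ a : ℝ) : EReal) +
    ⨆ γ ∈ augCouplingsMoment S G μ, ((augCost V W b a γ : ℝ) : EReal)

/-- `ε̄ = (Σ_i W̄_{1,μ_i}([μ_i]_{G_i})) · sup {‖Wᵀ l‖_∞ : l ∈ S}`; the norm of `Fin N → ℝ` is the
maximum norm. -/
def epsBar {N K₂ : ℕ} (W : Matrix (Fin K₂) (Fin N) ℝ) (S : Set (Fin K₂ → ℝ))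
    {X : Fin N → Set ℝ} (G : ∀ i, Set (X i → ℝ)) (μ : ∀ i, Measure (X i)) : ℝ :=
  (∑ i, supW₁ (G i) (μ i)) * sSup ((fun l : Fin K₂ → ℝ => ‖Wᵀ *ᵥ l‖) '' S)

end MarginalDRO

end

open MarginalDRO

open MeasureTheory ProbabilityTheory
open scoped Matrix

namespace MarginalDRO

/-! ### Gluing along the coordinates -/

/-! For fixed `l`, the integrand `Qaug` is Lipschitz in `x`: Hölder's inequality gives the constant
`‖Wᵀ *ᵥ l‖` against the ℓ¹ distance (`Qaug_sub_le`). Integrated along a plan that moves `x` and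
keeps `l`, this bounds the loss by the summed transport costs times the supremum of these constants
(`augCost_sub_le`). For a partial reassembly the costs are exactly Wasserstein distances, at most
`supW₁`. This gives (i), and also (ii), since the augmented couplings of `μ` form a subset of those
of the moment sets.

For the lower bound in (iii), near-optimal couplings are glued onto a given measure
(`exists_glued_measure`), and `l` is then discarded using `Qaug ≤ Q`. For the upper bound, a
coupling is lifted along a measurable near-maximizer (`exists_measurable_selection`). Both
constructions lose an arbitrary `δ > 0`, so neither optimal couplings nor exact selectors are
needed; `iSup_coe_le_iSup_coe_add` removes the slack. Taking infima gives (iv). -/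

theorem measurable_measure_pi {N : ℕ} {Ω : Type} [MeasurableSpace Ω] {Y : Fin N → Type}
    [∀ i, MeasurableSpace (Y i)] (κ : ∀ i, Ω → Measure (Y i))
    [∀ i ω, IsProbabilityMeasure (κ i ω)] (hκ : ∀ i, Measurable (κ i)) :
    Measurable fun ω => Measure.pi fun i => κ i ω := by
  refine Measurable.measure_of_isPiSystem_of_isProbabilityMeasure generateFrom_pi.symm
    isPiSystem_pi ?_
  rintro _ ⟨s, hs, rfl⟩
  simp only [Measure.pi_pi]
  refine Finset.measurable_prod _ fun i _ => ?_
  exact (Measure.measurable_coe (hs i (Set.mem_univ i))).comp (hκ i)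

/-- A probability measure on `(∏ i, Y i) × S` and couplings `π i` of its marginals with other
measures can be glued together. -/
theorem exists_glued_measure {N : ℕ} {Y : Fin N → Type} [∀ i, MeasurableSpace (Y i)]
    [∀ i, StandardBorelSpace (Y i)] [∀ i, Nonempty (Y i)] {S : Type} [MeasurableSpace S]
    (m : Measure ((∀ i, Y i) × S)) [IsProbabilityMeasure m] (π : ∀ i, Measure (Y i × Y i))
    [∀ i, IsProbabilityMeasure (π i)]
    (hπ : ∀ i, (π i).map Prod.fst = m.map fun p => p.1 i) :
    ∃ γ : Measure ((∀ i, Y i) × (∀ i, Y i) × S), IsProbabilityMeasure γ ∧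
      γ.map (fun p => (p.1, p.2.2)) = m ∧ ∀ i, γ.map (fun p => (p.1 i, p.2.1 i)) = π i := by
  -- Given `(x, l)`, the new coordinates are drawn independently, the `i`-th from the conditional
  -- law of `π i` given its first component `x i`.
  let κ : ∀ i, (∀ i, Y i) × S → Measure (Y i) := fun i p => (π i).condKernel (p.1 i)
  have hκ : ∀ i, Measurable (κ i) := fun i =>
    (π i).condKernel.measurable.comp ((measurable_pi_apply i).comp measurable_fst)
  let η : Kernel ((∀ i, Y i) × S) (∀ i, Y i) :=
    ⟨fun p => Measure.pi fun i => κ i p, measurable_measure_pi κ hκ⟩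
  have hη : ∀ p, η p = Measure.pi fun i => κ i p := fun _ => rfl
  have : IsMarkovKernel η := ⟨fun p => by rw [hη]; infer_instance⟩
  have hf : Measurable fun q : ((∀ i, Y i) × S) × (∀ i, Y i) => (q.1.1, q.2, q.1.2) := by fun_prop
  refine ⟨(m ⊗ₘ η).map fun q => (q.1.1, q.2, q.1.2),
    Measure.isProbabilityMeasure_map hf.aemeasurable, ?_, fun i => ?_⟩
  · rw [Measure.map_map (by fun_prop) hf]
    exact Measure.fst_compProd m η
  · rw [Measure.map_map (by fun_prop) hf]
    have hg : Measurable
        ((fun p : (∀ i, Y i) × (∀ i, Y i) × S => (p.1 i, p.2.1 i)) ∘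
          fun q : ((∀ i, Y i) × S) × (∀ i, Y i) => (q.1.1, q.2, q.1.2)) := by fun_prop
    have hpi : π i = (m.map fun p => p.1 i) ⊗ₘ (π i).condKernel := by
      rw [← hπ i]
      exact ((π i).disintegrate (π i).condKernel).symm
    have := Measure.isProbabilityMeasure_map (μ := m ⊗ₘ η) hg.aemeasurable
    have hev : Measurable fun p : (∀ i, Y i) × S => p.1 i := by fun_prop
    have := Measure.isProbabilityMeasure_map (μ := m) hev.aemeasurable
    refine Measure.ext_prod fun {s t} hs ht => ?_
    rw [Measure.map_apply hg (hs.prod ht)]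
    conv_rhs => rw [hpi]
    rw [Measure.compProd_apply_prod hs ht,
      setLIntegral_map hs ((π i).condKernel.measurable_coe ht) hev]
    have : ((fun p : (∀ i, Y i) × (∀ i, Y i) × S => (p.1 i, p.2.1 i)) ∘
        fun q : ((∀ i, Y i) × S) × (∀ i, Y i) => (q.1.1, q.2, q.1.2)) ⁻¹' s ×ˢ t =
        ((fun p : (∀ i, Y i) × S => p.1 i) ⁻¹' s) ×ˢ ((fun y : ∀ i, Y i => y i) ⁻¹' t) := by
      ext; simp
    rw [this, Measure.compProd_apply_prod (hev hs) (measurable_pi_apply i ht)]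
    -- The `i`-th marginal of the product of probability measures is `κ i p`.
    refine lintegral_congr fun p => ?_
    rw [hη, ← Measure.map_apply (measurable_pi_apply i) ht,
      (measurePreserving_eval (fun i => κ i p) i).map_eq]

/-! ### The Wasserstein distance -/

section Wasserstein

variable {Y : Set ℝ} {μ ν : Measure Y}

theorem integrable_abs_sub [CompactSpace Y] (γ : Measure (Y × Y)) [IsFiniteMeasure γ] :
    Integrable (fun p => |(p.1 : ℝ) - (p.2 : ℝ)|) γ :=
  Continuous.integrable_of_hasCompactSupport (by fun_prop) (HasCompactSupport.of_compactSpace _)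

theorem couplings₂_nonempty [IsProbabilityMeasure μ] [IsProbabilityMeasure ν] :
    (couplings₂ μ ν).Nonempty :=
  ⟨μ.prod ν, inferInstance, Measure.fst_prod, Measure.snd_prod⟩

theorem bddBelow_W₁ :
    BddBelow ((fun γ : Measure (Y × Y) => ∫ p, |(p.1 : ℝ) - (p.2 : ℝ)| ∂γ) '' couplings₂ μ ν) :=
  ⟨0, by rintro _ ⟨γ, _, rfl⟩; exact integral_nonneg fun _ => abs_nonneg _⟩

theorem exists_coupling_lt_W₁_add [IsProbabilityMeasure μ] [IsProbabilityMeasure ν] {δ : ℝ}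
    (hδ : 0 < δ) :
    ∃ γ ∈ couplings₂ μ ν, ∫ p, |(p.1 : ℝ) - (p.2 : ℝ)| ∂γ < W₁ μ ν + δ := by
  obtain ⟨_, ⟨γ, hγ, rfl⟩, h⟩ := Real.lt_sInf_add_pos
    ((couplings₂_nonempty (μ := μ) (ν := ν)).image fun γ : Measure (Y × Y) => ∫ p, |(p.1 : ℝ) - (p.2 : ℝ)| ∂γ) hδ
  exact ⟨γ, hγ, h⟩

theorem swap_mem_couplings₂ {γ : Measure (Y × Y)} (h : γ ∈ couplings₂ μ ν) :
    γ.map Prod.swap ∈ couplings₂ ν μ := by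
  obtain ⟨h1, h2, h3⟩ := h
  refine ⟨Measure.isProbabilityMeasure_map measurable_swap.aemeasurable, ?_, ?_⟩
  · rw [Measure.map_map measurable_fst measurable_swap]; exact h3
  · rw [Measure.map_map measurable_snd measurable_swap]; exact h2

/-- Reassemblies transport towards `μ i`, whereas `supW₁` measures from `μ i`; swapping couplings
reconciles the two. -/
theorem W₁_comm (μ ν : Measure Y) : W₁ μ ν = W₁ ν μ := by
  have key : ∀ μ ν : Measure Y,
      (fun γ : Measure (Y × Y) => ∫ p, |(p.1 : ℝ) - (p.2 : ℝ)| ∂γ) '' couplings₂ μ ν ⊆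
        (fun γ : Measure (Y × Y) => ∫ p, |(p.1 : ℝ) - (p.2 : ℝ)| ∂γ) '' couplings₂ ν μ := by
    rintro μ ν _ ⟨γ, hγ, rfl⟩
    refine ⟨_, swap_mem_couplings₂ hγ, ?_⟩
    have : Measurable fun p : Y × Y => |(p.1 : ℝ) - (p.2 : ℝ)| := by fun_prop
    simp only
    rw [integral_map measurable_swap.aemeasurable this.aestronglyMeasurable]
    simp only [Prod.fst_swap, Prod.snd_swap, abs_sub_comm]
  unfold W₁
  rw [(key μ ν).antisymm (key ν μ)]

/-- Provides the upper bound without which the real `sSup` in `supW₁` would not dominate its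
members. -/
theorem W₁_le_diam [CompactSpace Y] [IsProbabilityMeasure μ] [IsProbabilityMeasure ν] :
    W₁ μ ν ≤ Metric.diam Y := by
  obtain ⟨γ, hγ⟩ := couplings₂_nonempty (μ := μ) (ν := ν)
  have := hγ.1
  refine (csInf_le bddBelow_W₁ ⟨γ, hγ, rfl⟩).trans ?_
  calc ∫ p, |(p.1 : ℝ) - (p.2 : ℝ)| ∂γ ≤ ∫ _, Metric.diam Y ∂γ :=
        integral_mono (integrable_abs_sub γ) (integrable_const _) fun p =>
          Metric.dist_le_diam_of_mem (isCompact_iff_compactSpace.2 ‹_›).isBounded p.1.2 p.2.2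
    _ = Metric.diam Y := by simp

theorem W₁_le_supW₁ [CompactSpace Y] [IsProbabilityMeasure μ] {G : Set (Y → ℝ)}
    (hν : ν ∈ momentSet G μ) : W₁ μ ν ≤ supW₁ G μ := by
  refine le_csSup ⟨Metric.diam Y, ?_⟩ ⟨ν, hν, rfl⟩
  rintro _ ⟨ν', hν', rfl⟩
  have := hν'.1.1
  exact W₁_le_diam

end Wasserstein

theorem self_mem_momentSet {Y : Type} [MeasurableSpace Y] {G : Set (Y → ℝ)} {μ : Measure Y}
    [IsProbabilityMeasure μ] (hG : ∀ g ∈ G, Integrable g μ) : μ ∈ momentSet G μ :=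
  ⟨⟨inferInstance, hG⟩, fun _ _ => rfl⟩

theorem augCouplings_subset_augCouplingsMoment {N : ℕ} {Y : Fin N → Type}
    [∀ i, MeasurableSpace (Y i)] (S : Type) [MeasurableSpace S] {G : ∀ i, Set (Y i → ℝ)}
    {μ : ∀ i, Measure (Y i)} [∀ i, IsProbabilityMeasure (μ i)]
    (hG : ∀ i, ∀ g ∈ G i, Integrable g (μ i)) :
    augCouplings S μ ⊆ augCouplingsMoment S G μ :=
  fun _ hγ => ⟨μ, fun i => self_mem_momentSet (hG i), hγ⟩

/-! ### The cost functions -/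

theorem IsPolytope.isCompact {K : ℕ} {S : Set (Fin K → ℝ)} (hS : IsPolytope S) : IsCompact S := by
  obtain ⟨hb, n, A, d, rfl⟩ := hS
  exact Metric.isCompact_of_isClosed_isBounded
    (isClosed_le (by fun_prop) continuous_const) hb

section Cost

variable {N K₁ K₂ : ℕ} (V : Matrix (Fin K₂) (Fin K₁) ℝ) (W : Matrix (Fin K₂) (Fin N) ℝ)
  (b : Fin K₂ → ℝ) {S : Set (Fin K₂ → ℝ)} {X : Fin N → Set ℝ} (a : Fin K₁ → ℝ)

theorem continuous_Qaug :
    Continuous fun p : (Fin N → ℝ) × (Fin K₂ → ℝ) => Qaug V W b a p.1 p.2 := by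
  unfold Qaug
  fun_prop

theorem continuous_Qaug_subtype : Continuous fun p : (∀ i, X i) × S =>
    Qaug V W b a (fun i => (p.1 i : ℝ)) (p.2 : Fin K₂ → ℝ) :=
  (continuous_Qaug V W b a).comp
    (f := fun p : (∀ i, X i) × S => ((fun i => (p.1 i : ℝ)), (p.2 : Fin K₂ → ℝ))) (by fun_prop)

theorem continuous_Q (hS : IsCompact S) : Continuous fun x => Q V W b S a x :=
  hS.continuous_sSup (continuous_Qaug V W b a)

theorem Qaug_le_Q (hS : IsCompact S) (x : Fin N → ℝ) {l : Fin K₂ → ℝ} (hl : l ∈ S) :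
    Qaug V W b a x l ≤ Q V W b S a x := by
  refine le_csSup (hS.image ?_).bddAbove ⟨l, hl, rfl⟩
  exact (continuous_Qaug V W b a).comp (f := fun l => (x, l)) (by fun_prop)

/-- The terms in `V` and `b` cancel, leaving a pairing of `x - y` with `Wᵀ *ᵥ l`, bounded by ℓ¹–ℓ^∞
duality. -/
theorem Qaug_sub_le (x y : Fin N → ℝ) (l : Fin K₂ → ℝ) :
    Qaug V W b a x l - Qaug V W b a y l ≤ ‖Wᵀ *ᵥ l‖ * ∑ i, |x i - y i| := by
  have h : Qaug V W b a x l - Qaug V W b a y l = (x - y) ⬝ᵥ (Wᵀ *ᵥ l) := by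
    unfold Qaug
    rw [← sub_dotProduct, Matrix.mulVec_transpose, dotProduct_comm (x - y),
      ← Matrix.dotProduct_mulVec, dotProduct_comm l, Matrix.mulVec_sub]
    congr 1
    abel
  rw [h, dotProduct, Finset.mul_sum]
  refine Finset.sum_le_sum fun i _ => ?_
  calc (x - y) i * (Wᵀ *ᵥ l) i ≤ |(x - y) i * (Wᵀ *ᵥ l) i| := le_abs_self _
    _ = |(Wᵀ *ᵥ l) i| * |x i - y i| := by rw [abs_mul, mul_comm]; rfl
    _ ≤ _ := mul_le_mul_of_nonneg_right (norm_le_pi_norm (Wᵀ *ᵥ l) i) (abs_nonneg _)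

theorem sSup_norm_nonneg : 0 ≤ sSup ((fun l : Fin K₂ → ℝ => ‖Wᵀ *ᵥ l‖) '' S) :=
  Real.sSup_nonneg (by rintro _ ⟨l, _, rfl⟩; exact norm_nonneg _)

/-- Some member of a dense sequence in `S` is always `δ`-optimal, by continuity in `l`. Choosing the
first such index is measurable because each condition defines a closed set of `x`. -/
theorem exists_measurable_selection [CompactSpace S] [Nonempty S] {δ : ℝ} (hδ : 0 < δ) :
    ∃ l : (∀ i, X i) → S, Measurable l ∧ ∀ x, Q V W b S a (fun i => (x i : ℝ)) ≤
      Qaug V W b a (fun i => (x i : ℝ)) (l x : Fin K₂ → ℝ) + δ := by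
  classical
  have hS : IsCompact S := isCompact_iff_compactSpace.2 ‹_›
  have hc := continuous_Qaug_subtype V W b a (X := X) (S := S)
  have hQ : Continuous fun x : ∀ i, X i => Q V W b S a (fun i => (x i : ℝ)) :=
    (continuous_Q V W b a hS).comp (by fun_prop)
  let s := TopologicalSpace.denseSeq S
  let P : ℕ → (∀ i, X i) → Prop := fun n x => Q V W b S a (fun i => (x i : ℝ)) ≤
    Qaug V W b a (fun i => (x i : ℝ)) (s n : Fin K₂ → ℝ) + δ
  have hP : ∀ x, ∃ n, P n x := by
    intro x
    obtain ⟨_, ⟨l, hl, rfl⟩, hlt⟩ := exists_lt_of_lt_csSup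
      ((Set.nonempty_coe_sort.1 ‹Nonempty S›).image
        fun l => Qaug V W b a (fun i => (x i : ℝ)) l)
      (sub_lt_self (Q V W b S a (fun i => (x i : ℝ))) hδ)
    have hopen : IsOpen {l : S | Q V W b S a (fun i => (x i : ℝ)) - δ <
        Qaug V W b a (fun i => (x i : ℝ)) (l : Fin K₂ → ℝ)} :=
      isOpen_lt continuous_const (hc.comp (f := fun l => (x, l)) (by fun_prop))
    obtain ⟨n, hn⟩ := (TopologicalSpace.denseRange_denseSeq S).exists_mem_open hopen ⟨⟨l, hl⟩, hlt⟩
    exact ⟨n, by have := Set.mem_ofPred.1 hn; simp only [P, s]; linarith⟩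
  refine ⟨fun x => s (Nat.find (hP x)), Measurable.find (f := fun n _ => s n)
    (fun n => measurable_const) (fun n => ?_) hP, fun x => Nat.find_spec (hP x)⟩
  have hcn : Continuous fun x : ∀ i, X i =>
      Qaug V W b a (fun i => (x i : ℝ)) (s n : Fin K₂ → ℝ) + δ :=
    (hc.comp (f := fun x => (x, s n)) (by fun_prop)).add continuous_const
  exact (isClosed_le hQ hcn).measurableSet

variable [∀ i, CompactSpace (X i)] [CompactSpace S]

theorem integrable_Qaug (γ : Measure ((∀ i, X i) × S)) [IsFiniteMeasure γ] :
    Integrable (fun p => Qaug V W b a (fun i => (p.1 i : ℝ)) (p.2 : Fin K₂ → ℝ)) γ :=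
  (continuous_Qaug_subtype V W b a).integrable_of_hasCompactSupport
    (HasCompactSupport.of_compactSpace _)

theorem integrable_Q (γ : Measure (∀ i, X i)) [IsFiniteMeasure γ] :
    Integrable (fun x => Q V W b S a (fun i => (x i : ℝ))) γ :=
  ((continuous_Q V W b a (isCompact_iff_compactSpace.2 ‹_›)).comp
    (by fun_prop)).integrable_of_hasCompactSupport (HasCompactSupport.of_compactSpace _)

/-- Moving the coordinates along a plan changes the cost by at most the transport cost. -/
theorem augCost_sub_le (γ : Measure ((∀ i, X i) × (∀ i, X i) × S)) [IsProbabilityMeasure γ] :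
    augCost V W b a (γ.map fun p => (p.1, p.2.2)) - augCost V W b a (γ.map fun p => (p.2.1, p.2.2))
      ≤ (∑ i, ∫ p, |(p.1 i : ℝ) - (p.2.1 i : ℝ)| ∂γ) *
        sSup ((fun l : Fin K₂ → ℝ => ‖Wᵀ *ᵥ l‖) '' S) := by
  have hS : IsCompact S := isCompact_iff_compactSpace.2 ‹_›
  set M := sSup ((fun l : Fin K₂ → ℝ => ‖Wᵀ *ᵥ l‖) '' S)
  have hM : ∀ l ∈ S, ‖Wᵀ *ᵥ l‖ ≤ M := fun l hl =>
    le_csSup (hS.image (by fun_prop)).bddAbove ⟨l, hl, rfl⟩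
  have hc := continuous_Qaug_subtype V W b a (X := X) (S := S)
  have hf : Continuous fun p : (∀ i, X i) × (∀ i, X i) × S => (p.1, p.2.2) := by fun_prop
  have hg : Continuous fun p : (∀ i, X i) × (∀ i, X i) × S => (p.2.1, p.2.2) := by fun_prop
  have hd : ∀ i, Continuous fun p : (∀ i, X i) × (∀ i, X i) × S =>
      |(p.1 i : ℝ) - (p.2.1 i : ℝ)| := fun i => by fun_prop
  have hint : ∀ {f : (∀ i, X i) × (∀ i, X i) × S → ℝ}, Continuous f → Integrable f γ := fun hf =>
    hf.integrable_of_hasCompactSupport (HasCompactSupport.of_compactSpace _)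
  unfold augCost
  rw [integral_map hf.measurable.aemeasurable hc.measurable.aestronglyMeasurable,
    integral_map hg.measurable.aemeasurable hc.measurable.aestronglyMeasurable,
    ← integral_sub (by exact hint (hc.comp hf)) (by exact hint (hc.comp hg))]
  rw [← integral_finsetSum _ fun i _ => hint (hd i), mul_comm, ← integral_const_mul]
  refine integral_mono ((hint (hc.comp hf)).sub (hint (hc.comp hg)))
    (hint (by fun_prop)) fun p => ?_
  exact (Qaug_sub_le V W b a _ _ _).trans
    (mul_le_mul_of_nonneg_right (hM _ p.2.2.2) (Finset.sum_nonneg fun i _ => abs_nonneg _))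

theorem exists_couplings_augCost_le {μ : ∀ i, Measure (X i)}
    {γ : Measure ((∀ i, X i) × S)} (hγ : γ ∈ augCouplings S μ) :
    ∃ γ' ∈ couplings μ, augCost V W b a γ ≤ ∫ x, Q V W b S a (fun i => (x i : ℝ)) ∂γ' := by
  have hS : IsCompact S := isCompact_iff_compactSpace.2 ‹_›
  obtain ⟨hprob, hγ⟩ := hγ
  have hfst := Measure.isProbabilityMeasure_map (μ := γ) measurable_fst.aemeasurable
  have hQ := integrable_Q V W b a (S := S) (γ.map Prod.fst)
  refine ⟨γ.map Prod.fst, ⟨hfst, fun i => ?_⟩, ?_⟩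
  · rw [Measure.map_map (by fun_prop) measurable_fst]
    exact hγ i
  · rw [integral_map measurable_fst.aemeasurable hQ.aestronglyMeasurable]
    exact integral_mono (integrable_Qaug V W b a γ)
      (hQ.comp_measurable measurable_fst) fun p => Qaug_le_Q V W b a hS _ p.2.2

theorem exists_augCouplings_integral_Q_le [Nonempty S] {μ : ∀ i, Measure (X i)}
    {γ : Measure (∀ i, X i)}
    (hγ : γ ∈ couplings μ) {δ : ℝ} (hδ : 0 < δ) :
    ∃ γ' ∈ augCouplings S μ,
      ∫ x, Q V W b S a (fun i => (x i : ℝ)) ∂γ ≤ augCost V W b a γ' + δ := by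
  obtain ⟨hprob, hγ⟩ := hγ
  obtain ⟨l, hl, hle⟩ := exists_measurable_selection V W b a (S := S) (X := X) hδ
  have hm : Measurable fun x => (x, l x) := by fun_prop
  have hprob' := Measure.isProbabilityMeasure_map (μ := γ) hm.aemeasurable
  have hint := integrable_Qaug V W b a (γ.map fun x => (x, l x))
  refine ⟨γ.map fun x => (x, l x), ⟨hprob', fun i => ?_⟩, ?_⟩
  · rw [Measure.map_map (by fun_prop) hm]
    exact hγ i
  · unfold augCost
    rw [integral_map hm.aemeasurable hint.aestronglyMeasurable]
    have hint' : Integrable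
        (fun x : ∀ i, X i => Qaug V W b a (fun i => (x i : ℝ)) (l x : Fin K₂ → ℝ)) γ :=
      hint.comp_measurable hm
    calc _ ≤ ∫ x, (Qaug V W b a (fun i => (x i : ℝ)) (l x : Fin K₂ → ℝ) + δ) ∂γ :=
          integral_mono (integrable_Q V W b a γ) (hint'.add (integrable_const δ)) hle
      _ = _ := by rw [integral_add hint' (integrable_const δ)]; simp

variable {G : ∀ i, Set (X i → ℝ)} {μ : ∀ i, Measure (X i)} [∀ i, IsProbabilityMeasure (μ i)]

theorem augCost_sub_le_epsBar {μhat μtil : Measure ((∀ i, X i) × S)}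
    (hhat : μhat ∈ augCouplingsMoment S G μ) (htil : μtil ∈ partialReassemblies μhat μ) :
    augCost V W b a μhat - augCost V W b a μtil ≤ epsBar W S G μ := by
  obtain ⟨ν, hν, -, hhat⟩ := hhat
  obtain ⟨-, γ, hγ, h1, h2, h3⟩ := htil
  have h := augCost_sub_le V W b a γ
  rw [h1, h3] at h
  refine h.trans (mul_le_mul_of_nonneg_right (Finset.sum_le_sum fun i _ => ?_)
    (sSup_norm_nonneg W))
  have hi := (h2 i).2
  rw [integral_map (by fun_prop) (Measurable.aestronglyMeasurable (by fun_prop)), hhat i,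
    W₁_comm] at hi
  exact hi.trans_le (W₁_le_supW₁ (hν i))

/-- Approximate form of the existence of partial reassemblies. -/
theorem exists_augCouplings_augCost_le [∀ i, Nonempty (X i)] {μhat : Measure ((∀ i, X i) × S)}
    (hhat : μhat ∈ augCouplingsMoment S G μ) {δ : ℝ} (hδ : 0 < δ) :
    ∃ μtil ∈ augCouplings S μ,
      augCost V W b a μhat ≤ augCost V W b a μtil + epsBar W S G μ + δ := by
  obtain ⟨ν, hν, hprob, hhat⟩ := hhat
  set M := sSup ((fun l : Fin K₂ → ℝ => ‖Wᵀ *ᵥ l‖) '' S) with hM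
  have hM0 : 0 ≤ M := sSup_norm_nonneg W
  have hN : (0 : ℝ) ≤ N := N.cast_nonneg
  -- Each of the `N` couplings may exceed the optimal cost by `η`, and the excess is multiplied by
  -- `M`. The `+ 1` in the denominator covers `N * M = 0`.
  obtain ⟨η, hη, hηδ⟩ : ∃ η : ℝ, 0 < η ∧ N * η * M ≤ δ := by
    refine ⟨δ / (N * M + 1), by positivity, ?_⟩
    rw [mul_div_assoc', div_mul_eq_mul_div, div_le_iff₀ (by positivity)]
    nlinarith
  have (i : Fin N) : IsProbabilityMeasure (ν i) := (hν i).1.1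
  have (i : Fin N) : StandardBorelSpace (X i) :=
    (isCompact_iff_compactSpace.2 (inferInstance : CompactSpace (X i))).measurableSet.standardBorel
  choose π hπ hπη using fun i => exists_coupling_lt_W₁_add (μ := ν i) (ν := μ i) hη
  have (i : Fin N) : IsProbabilityMeasure (π i) := (hπ i).1
  obtain ⟨γ, hγ, h1, h2⟩ := exists_glued_measure μhat π fun i => by rw [hhat i, (hπ i).2.1]
  have hg : Measurable fun p : (∀ i, X i) × (∀ i, X i) × S => (p.2.1, p.2.2) := by fun_prop
  refine ⟨γ.map fun p => (p.2.1, p.2.2),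
    ⟨Measure.isProbabilityMeasure_map hg.aemeasurable, fun i => ?_⟩, ?_⟩
  · rw [Measure.map_map (by fun_prop) hg, ← (hπ i).2.2, ← h2 i,
      Measure.map_map (by fun_prop) (by fun_prop)]
    rfl
  · have h := augCost_sub_le V W b a γ
    rw [h1] at h
    have hle : ∑ i, ∫ p, |(p.1 i : ℝ) - (p.2.1 i : ℝ)| ∂γ ≤
        ∑ i, supW₁ (G i) (μ i) + N * η := by
      calc _ ≤ ∑ i : Fin N, (supW₁ (G i) (μ i) + η) := by
            refine Finset.sum_le_sum fun i _ => ?_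
            have hi := hπη i
            rw [← h2 i, integral_map (by fun_prop)
              (Measurable.aestronglyMeasurable (by fun_prop))] at hi
            have := W₁_le_supW₁ (hν i)
            rw [W₁_comm] at this
            linarith
        _ = _ := by simp [Finset.sum_add_distrib]
    have h' := h.trans (mul_le_mul_of_nonneg_right hle hM0)
    rw [add_mul] at h'
    unfold epsBar
    linarith

end Cost

/-! ### Suprema in the extended reals -/

/-- Any real `y` strictly between the right supremum and `f i - e` is contradicted by taking the
slack `δ = f i - e - y`, which forces `y ≤ g j`. -/
theorem iSup_coe_le_iSup_coe_add {α β : Type*} {s : Set α} {t : Set β} {f : α → ℝ} {g : β → ℝ}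
    {e : ℝ} (h : ∀ i ∈ s, ∀ δ > 0, ∃ j ∈ t, f i ≤ g j + e + δ) :
    (⨆ i ∈ s, (f i : EReal)) ≤ (⨆ j ∈ t, (g j : EReal)) + e := by
  refine iSup₂_le fun i hi => ?_
  rw [← EReal.sub_le_iff_le_add (.inl (EReal.coe_ne_bot e)) (.inl (EReal.coe_ne_top e)),
    ← EReal.coe_sub]
  by_contra! hlt
  obtain ⟨y, hy, hyf⟩ := EReal.lt_iff_exists_real_btwn.1 hlt
  have hyf : y < f i - e := by exact_mod_cast hyf
  obtain ⟨j, hj, hle⟩ := h i hi (f i - e - y) (by linarith)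
  have hyg : (y : EReal) ≤ g j := by exact_mod_cast (by linarith : y ≤ g j)
  exact (hyg.trans (le_iSup₂ (f := fun j (_ : j ∈ t) => (g j : EReal)) j hj)).not_gt hy

end MarginalDRO

theorem theorem1 {N K₁ K₂ nin neq : ℕ}
    -- the uncertain quantities and their marginals
    (X : Fin N → Set ℝ) (hX_ne : ∀ i, (X i).Nonempty) (hX_compact : ∀ i, IsCompact (X i))
    (μ : ∀ i, Measure (X i)) (hμ : ∀ i, IsProbabilityMeasure (μ i))
    -- the first stage
    (c₁ : Fin K₁ → ℝ)
    (Lin : Matrix (Fin nin) (Fin K₁) ℝ) (qin : Fin nin → ℝ)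
    (Leq : Matrix (Fin neq) (Fin K₁) ℝ) (qeq : Fin neq → ℝ)
    (hS₁ : (firstStageSet Lin qin Leq qeq).Nonempty)
    -- the second stage, in dual form
    (V : Matrix (Fin K₂) (Fin K₁) ℝ) (W : Matrix (Fin K₂) (Fin N) ℝ) (b : Fin K₂ → ℝ)
    (S₂ : Set (Fin K₂ → ℝ)) (hS₂ : IsPolytope S₂) (hS₂_ne : S₂.Nonempty)
    -- the test functions of the moment sets
    (G : ∀ i, Set (X i → ℝ)) (hG : ∀ i, ∀ g ∈ G i, Measurable g ∧ Integrable g (μ i)) :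
    -- (i) loss of a partial reassembly
    (∀ μhat ∈ augCouplingsMoment S₂ G μ, ∀ μtil ∈ partialReassemblies μhat μ,
      (∫ p, (W *ᵥ (fun i => (p.1 i : ℝ)) + b) ⬝ᵥ (p.2 : Fin K₂ → ℝ) ∂μhat)
        - (∫ p, (W *ᵥ (fun i => (p.1 i : ℝ)) + b) ⬝ᵥ (p.2 : Fin K₂ → ℝ) ∂μtil)
        ≤ epsBar W S₂ G μ) ∧
    -- (ii) approximate optimizers reassemble into approximate optimizers
    (∀ ε : ℝ, 0 < ε → ∀ a ∈ firstStageSet Lin qin Leq qeq,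
      ∀ μhat ∈ augCouplingsMoment S₂ G μ,
        (⨆ γ ∈ augCouplingsMoment S₂ G μ, ((augCost V W b a γ : ℝ) : EReal)) - (ε : EReal)
          ≤ ((augCost V W b a μhat : ℝ) : EReal) →
        ∀ μtil ∈ partialReassemblies μhat μ,
          μtil ∈ augCouplings S₂ μ ∧
          (⨆ γ ∈ augCouplings S₂ μ, ((augCost V W b a γ : ℝ) : EReal))
              - ((ε + epsBar W S₂ G μ : ℝ) : EReal)
            ≤ ((augCost V W b a μtil : ℝ) : EReal)) ∧
    -- (iii) pointwise bounds
    (∀ a ∈ firstStageSet Lin qin Leq qeq,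
      phiSur c₁ V W b S₂ G μ a - (epsBar W S₂ G μ : EReal) ≤ phi c₁ V W b S₂ μ a ∧
      phi c₁ V W b S₂ μ a ≤ phiSur c₁ V W b S₂ G μ a) ∧
    -- (iv) bounds for the optimal values
    ((⨅ a ∈ firstStageSet Lin qin Leq qeq, phiSur c₁ V W b S₂ G μ a) - (epsBar W S₂ G μ : EReal)
        ≤ (⨅ a ∈ firstStageSet Lin qin Leq qeq, phi c₁ V W b S₂ μ a) ∧
      (⨅ a ∈ firstStageSet Lin qin Leq qeq, phi c₁ V W b S₂ μ a)
        ≤ ⨅ a ∈ firstStageSet Lin qin Leq qeq, phiSur c₁ V W b S₂ G μ a) := by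
  have hcpt (i : Fin N) : CompactSpace (X i) := isCompact_iff_compactSpace.1 (hX_compact i)
  have hne (i : Fin N) : Nonempty (X i) := (hX_ne i).to_subtype
  have hScpt : CompactSpace S₂ := isCompact_iff_compactSpace.1 hS₂.isCompact
  have hSne : Nonempty S₂ := hS₂_ne.to_subtype
  have hsub : augCouplings S₂ μ ⊆ augCouplingsMoment S₂ G μ :=
    augCouplings_subset_augCouplingsMoment S₂ fun i g hg => (hG i g hg).2
  have lower (a : Fin K₁ → ℝ) :
      phiSur c₁ V W b S₂ G μ a - (epsBar W S₂ G μ : EReal) ≤ phi c₁ V W b S₂ μ a := by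
    apply EReal.sub_le_of_le_add
    unfold phi phiSur
    rw [add_assoc]
    refine add_le_add_right (iSup_coe_le_iSup_coe_add fun γ hγ δ hδ => ?_) _
    obtain ⟨γ₁, hγ₁, h₁⟩ := exists_augCouplings_augCost_le V W b a hγ hδ
    obtain ⟨γ₂, hγ₂, h₂⟩ := exists_couplings_augCost_le V W b a hγ₁
    exact ⟨γ₂, hγ₂, by linarith⟩
  have upper (a : Fin K₁ → ℝ) : phi c₁ V W b S₂ μ a ≤ phiSur c₁ V W b S₂ G μ a := by
    refine add_le_add_right ?_ _
    have h := iSup_coe_le_iSup_coe_add (s := couplings μ) (t := augCouplingsMoment S₂ G μ)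
      (f := fun γ => ∫ x, Q V W b S₂ a (fun i => (x i : ℝ)) ∂γ) (g := augCost V W b a) (e := 0)
      fun γ hγ δ hδ => by
        obtain ⟨γ', hγ', h⟩ := exists_augCouplings_integral_Q_le V W b a (S := S₂) hγ hδ
        exact ⟨γ', hsub hγ', by linarith⟩
    simpa using h
  refine ⟨fun μhat hhat μtil htil => ?_, fun ε hε a _ μhat hhat hopt μtil htil => ?_,
    fun a _ => ⟨lower a, upper a⟩, ?_, ?_⟩
  -- At `a = 0` the `V` term vanishes, so (i) is an instance of the bound for `Qaug`.
  · have h := augCost_sub_le_epsBar V W b 0 hhat htil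
    simpa only [augCost, Qaug, Matrix.mulVec_zero, zero_add] using h
  · refine ⟨htil.1, EReal.sub_le_of_le_add ?_⟩
    have h := augCost_sub_le_epsBar V W b a hhat htil
    have hopt' := (EReal.sub_le_iff_le_add (.inl (EReal.coe_ne_bot ε))
      (.inl (EReal.coe_ne_top ε))).1 hopt
    -- Enlarging the feasible set only raises the supremum, so near-optimality over the moment sets
    -- also bounds the supremum over `augCouplings S₂ μ`.
    refine (biSup_mono hsub).trans (hopt'.trans ?_)
    rw [← EReal.coe_add, ← EReal.coe_add]
    exact_mod_cast (by linarith)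
  · exact le_iInf₂ fun a ha => (EReal.sub_le_sub (iInf₂_le a ha) le_rfl).trans (lower a)
  · exact iInf₂_mono fun a _ => upper a
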